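/- A combinatory algebra is a structure $(A,\cdot,K,S)$ with a binary operation (application, associating to the left) and two constants satisfying the identities $Kxy=x$ and $Sxyz=xz(yz)$. Put $I=SKK$, $\mathbf 1=\mathbf 1_1=S(KI)$ and $\mathbf 1_{n+1}=S(K\mathbf 1)(S(K\mathbf 1_n))$. A $\lambda$-model is a combinatory algebra such that, for all $x,y$, if $xz=yz$ for all $z$ then $\mathbf 1x=\mathbf 1y$, and such that $\mathbf 1_2K=K$ and $\mathbf 1_3S=S$. The $\lambda$-terms are interpreted in a $\lambda$-model under an environment $\rho$ (a function from variables to $A$) by $|x|_\rho=\rho(x)$, $|MN|_\rho=|M|_\rho|N|_\rho$ and $|\lambda x.M|_\rho=\mathbf 1a$, where $a$ is any element with $ab=|M|_{\rho[x:=b]}$ for all $b\in A$; the identity $M=N$ holds in the $\lambda$-model if $|M|_\rho=|N|_\rho$ for all $\rho$. Let $\Omega=(\lambda x.xx)(\lambda x.xx)$, $B=\lambda x.x(\lambda y.yx)$, $C=\lambda z.zB$ and $\Theta=BC$. In an arbitrary combinatory algebra, $\Omega$ denotes the element $(SII)(SII)$, which in a $\lambda$-model is the interpretation of the $\lambda$-term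 $\Omega$. A combinatory algebra $\mathbf B$ is $\Omega$-unorderable if, for every partial order on its underlying set for which application is monotone in both arguments, $\Omega$ is comparable with no element different from $\Omega$. A combinatory algebra $\mathbf A$ is absolutely $\Omega$-unorderable in the variety of combinatory algebras if every combinatory algebra $\mathbf B$ for which there is an embedding (an injective homomorphism preserving application, $K$ and $S$) $f:\mathbf A\to\mathbf B$ is $\Omega$-unorderable. Theorem. Every $\lambda$-model satisfying the subtractive identities $(\pi)\ \Theta xx=\Omega$ and $(\phi)\ \Theta x\Omega=x$ is absolutely $\Omega$-unorderable in the variety of combinatory algebras. -/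

import Mathlib

/-- A combinatory algebra `(A, ·, K, S)`: a binary operation (application) and two constants with
`K x y = x` and `S x y z = x z (y z)`. These two identities axiomatise the variety of
combinatory algebras. -/
class CombinatoryAlgebra (A : Type*) where
  app : A → A → A
  K : A
  S : A
  K_app : ∀ x y : A, app (app K x) y = x
  S_app : ∀ x y z : A, app (app (app S x) y) z = app (app x z) (app y z)

infixl:70 " ⬝ " => CombinatoryAlgebra.app

namespace CombinatoryAlgebra

/-- The combinator `I = S K K`. -/
def I {A : Type*} [CombinatoryAlgebra A] : A := S ⬝ K ⬝ K

/-- The combinator `𝟏 = 𝟏₁ = S (K I)`. -/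
def one {A : Type*} [CombinatoryAlgebra A] : A := S ⬝ (K ⬝ I)

/-- The combinator `𝟏₂ = S (K 𝟏) (S (K 𝟏₁))`. -/
def one₂ {A : Type*} [CombinatoryAlgebra A] : A := S ⬝ (K ⬝ one) ⬝ (S ⬝ (K ⬝ one))

/-- The combinator `𝟏₃ = S (K 𝟏) (S (K 𝟏₂))`. -/
def one₃ {A : Type*} [CombinatoryAlgebra A] : A := S ⬝ (K ⬝ one) ⬝ (S ⬝ (K ⬝ one₂))

/-- Ground (i.e. variable-free) terms in the similarity type of combinatory algebras. They name the
definable constants of combinatory algebras. -/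
inductive GroundTerm : Type
  | K : GroundTerm
  | S : GroundTerm
  | app : GroundTerm → GroundTerm → GroundTerm

/-- The value of a ground term in a combinatory algebra. -/
def GroundTerm.eval (A : Type*) [CombinatoryAlgebra A] : GroundTerm → A
  | .K => CombinatoryAlgebra.K
  | .S => CombinatoryAlgebra.S
  | .app s t => s.eval A ⬝ t.eval A

/-- The combinatory term `Ω = (S I I) (S I I)`, with `I = S K K`. -/
def GroundTerm.omega : GroundTerm :=
  let i := GroundTerm.app (.app .S .K) .K
  let w := GroundTerm.app (.app .S i) i
  .app w w

/-- An embedding of combinatory algebras: an injective homomorphism of `(·, K, S)`-algebras. -/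
structure IsEmbedding {A B : Type*} [CombinatoryAlgebra A] [CombinatoryAlgebra B]
    (f : A → B) : Prop where
  map_app : ∀ a b : A, f (a ⬝ b) = f a ⬝ f b
  map_K : f K = K
  map_S : f S = S
  injective : Function.Injective f

/-- A compatible partial order on a combinatory algebra: a partial order for which application
is monotone (compatibility with the two constants is reflexivity). -/
structure IsCompatibleOrder {A : Type*} [CombinatoryAlgebra A] (le : A → A → Prop) : Prop where
  refl : ∀ a : A, le a a
  antisymm : ∀ a b : A, le a b → le b a → a = b
  trans : ∀ a b c : A, le a b → le b c → le a c
  app_mono : ∀ a a' b b' : A, le a a' → le b b' → le (a ⬝ b) (a' ⬝ b')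

/-- `A` is `zero`-unorderable: under every compatible partial order, `zero` is comparable with
no other element. -/
def IsUnorderableAt {A : Type*} [CombinatoryAlgebra A] (zero : A) : Prop :=
  ∀ le : A → A → Prop, IsCompatibleOrder le → ∀ a : A, a ≠ zero → ¬ le zero a ∧ ¬ le a zero

/-- `A` is absolutely `t`-unorderable in the variety of combinatory algebras, where the ground
term `t` names the distinguished constant: every combinatory algebra `B` into which `A` embeds
is unorderable at the value of `t` in `B`. The algebras `B` range over an arbitrary universe `v`,
independent of that of `A`. -/
def IsAbsolutelyUnorderable.{u, v} (t : GroundTerm) (A : Type u) [CombinatoryAlgebra A] : Prop :=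
  ∀ (B : Type v) [CombinatoryAlgebra B] (f : A → B), IsEmbedding f →
    IsUnorderableAt (t.eval B)

end CombinatoryAlgebra

open CombinatoryAlgebra in
/-- A `λ`-model: a combinatory algebra satisfying the Meyer-Scott axiom (weak extensionality)
together with `𝟏₂ K = K` and `𝟏₃ S = S`. -/
class IsLambdaModel (A : Type*) [CombinatoryAlgebra A] : Prop where
  weak_ext : ∀ x y : A, (∀ z : A, x ⬝ z = y ⬝ z) → one ⬝ x = one ⬝ y
  one₂_K : one₂ ⬝ K = (K : A)
  one₃_S : one₃ ⬝ S = (S : A)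

/-- Raw terms of the untyped `λ`-calculus, with variables named by natural numbers. -/
inductive LambdaTerm : Type
  | var : ℕ → LambdaTerm
  | app : LambdaTerm → LambdaTerm → LambdaTerm
  | lam : ℕ → LambdaTerm → LambdaTerm

namespace LambdaTerm

open CombinatoryAlgebra (one)

/-- The interpretation of a `λ`-term under an environment `ρ`: an abstraction `λx.M` is interpreted
as `𝟏 a`, where `a` is any element representing `b ↦ |M|_{ρ[x := b]}`. In a `λ`-model such an `a`
exists and `𝟏 a` does not depend on it, see `exists_represents` and `interp_lam`. -/
noncomputable def interp {A : Type*} [CombinatoryAlgebra A] : LambdaTerm → (ℕ → A) → A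
  | var x, ρ => ρ x
  | app M N, ρ => M.interp ρ ⬝ N.interp ρ
  | lam x M, ρ =>
    haveI : Nonempty A := ⟨CombinatoryAlgebra.K⟩
    one ⬝ Classical.epsilon (fun a : A => ∀ b : A, a ⬝ b = M.interp (Function.update ρ x b))

/-- The identity `M = N` holds in `A`: both sides have the same interpretation under every
environment. -/
def Holds (A : Type*) [CombinatoryAlgebra A] (M N : LambdaTerm) : Prop :=
  ∀ ρ : ℕ → A, M.interp ρ = N.interp ρ

/-- `Ω = (λx.xx)(λx.xx)`. -/
def omega : LambdaTerm :=
  app (lam 0 (app (var 0) (var 0))) (lam 0 (app (var 0) (var 0)))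

/-- `B = λx.x(λy.yx)`. -/
def termB : LambdaTerm := lam 0 (app (var 0) (lam 1 (app (var 1) (var 0))))

/-- `C = λz.zB`. -/
def termC : LambdaTerm := lam 2 (app (var 2) termB)

/-- `Θ = BC`. -/
def theta : LambdaTerm := app termB termC

/-- The subtractive identity `(π)`: `Θxx = Ω`. -/
def SatisfiesPi (A : Type*) [CombinatoryAlgebra A] : Prop :=
  Holds A (app (app theta (var 0)) (var 0)) omega

/-- The subtractive identity `(φ)`: `ΘxΩ = x`. -/
def SatisfiesPhi (A : Type*) [CombinatoryAlgebra A] : Prop :=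
  Holds A (app (app theta (var 0)) omega) (var 0)

/-- Functions of an environment that are given by a combinatory polynomial. -/
inductive IsPoly {A : Type*} [CombinatoryAlgebra A] : ((ℕ → A) → A) → Prop
  | var (x : ℕ) : IsPoly (fun ρ => ρ x)
  | const (a : A) : IsPoly (fun _ => a)
  | app {F G : (ℕ → A) → A} : IsPoly F → IsPoly G → IsPoly (fun ρ => F ρ ⬝ G ρ)

theorem IsPoly.abstract {A : Type*} [CombinatoryAlgebra A] {F : (ℕ → A) → A} (hF : IsPoly F)
    (x : ℕ) : ∃ G : (ℕ → A) → A, IsPoly G ∧ ∀ ρ b, G ρ ⬝ b = F (Function.update ρ x b) := by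
  induction hF with
  | var y =>
    by_cases h : y = x
    · refine ⟨_, .const CombinatoryAlgebra.I, fun ρ b => ?_⟩
      simp [h, CombinatoryAlgebra.I, CombinatoryAlgebra.S_app, CombinatoryAlgebra.K_app]
    · refine ⟨_, .app (.const CombinatoryAlgebra.K) (.var y), fun ρ b => ?_⟩
      simp [h, CombinatoryAlgebra.K_app]
  | const a =>
    exact ⟨_, .const (CombinatoryAlgebra.K ⬝ a), fun ρ b => CombinatoryAlgebra.K_app _ _⟩
  | app _ _ ihF ihG =>
    obtain ⟨F', hF', eF⟩ := ihF
    obtain ⟨G', hG', eG⟩ := ihG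
    refine ⟨_, .app (.app (.const CombinatoryAlgebra.S) hF') hG', fun ρ b => ?_⟩
    simp [CombinatoryAlgebra.S_app, eF, eG]

theorem isPoly_interp {A : Type*} [CombinatoryAlgebra A] [IsLambdaModel A] (M : LambdaTerm) :
    IsPoly (M.interp : (ℕ → A) → A) := by
  induction M with
  | var x => exact .var x
  | app M N ihM ihN => exact .app ihM ihN
  | lam x M ih =>
    obtain ⟨G, hG, eG⟩ := ih.abstract x
    convert IsPoly.app (.const one) hG using 1
    funext ρ
    refine IsLambdaModel.weak_ext (A := A) _ _ fun z => ?_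
    rw [eG]
    exact Classical.epsilon_spec
      (p := fun a : A => ∀ b : A, a ⬝ b = M.interp (Function.update ρ x b)) ⟨G ρ, eG ρ⟩ z

/-- In a `λ`-model the function `b ↦ |M|_{ρ[x := b]}` is representable. -/
theorem exists_represents {A : Type*} [CombinatoryAlgebra A] [IsLambdaModel A]
    (M : LambdaTerm) (x : ℕ) (ρ : ℕ → A) :
    ∃ a : A, ∀ b : A, a ⬝ b = M.interp (Function.update ρ x b) := by
  obtain ⟨G, -, eG⟩ := (isPoly_interp (A := A) M).abstract x
  exact ⟨G ρ, eG ρ⟩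

/-- In a `λ`-model `|λx.M|_ρ = 𝟏 a` for every `a` representing `b ↦ |M|_{ρ[x := b]}`. -/
theorem interp_lam {A : Type*} [CombinatoryAlgebra A] [IsLambdaModel A]
    (M : LambdaTerm) (x : ℕ) (ρ : ℕ → A) (a : A)
    (ha : ∀ b : A, a ⬝ b = M.interp (Function.update ρ x b)) :
    (lam x M).interp ρ = one ⬝ a := by
  refine IsLambdaModel.weak_ext (A := A) _ _ fun z => ?_
  rw [ha]
  exact Classical.epsilon_spec
    (p := fun a : A => ∀ b : A, a ⬝ b = M.interp (Function.update ρ x b)) ⟨a, ha⟩ z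

theorem one_app {A : Type*} [CombinatoryAlgebra A] (a b : A) : one ⬝ a ⬝ b = a ⬝ b := by
  simp [one, CombinatoryAlgebra.I, CombinatoryAlgebra.S_app, CombinatoryAlgebra.K_app]

open CombinatoryAlgebra in
/-- In a `λ`-model the `λ`-term `Ω` is interpreted as the value of the combinatory term `Ω`. -/
theorem interp_omega {A : Type*} [CombinatoryAlgebra A] [IsLambdaModel A] (ρ : ℕ → A) :
    omega.interp ρ = CombinatoryAlgebra.GroundTerm.omega.eval A := by
  have hS : ∀ x y : A, one ⬝ (S ⬝ x ⬝ y) = S ⬝ x ⬝ y := fun x y => by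
    have h : (one₃ : A) ⬝ S ⬝ x ⬝ y = S ⬝ x ⬝ y := by rw [IsLambdaModel.one₃_S]
    rw [← h]
    simp only [one₃, one₂, S_app, K_app, one_app]
    exact IsLambdaModel.weak_ext _ _ fun z => one_app _ z
  have hw : (lam 0 (app (var 0) (var 0))).interp ρ = (S ⬝ I ⬝ I : A) := by
    rw [interp_lam _ _ _ (S ⬝ I ⬝ I : A), hS]
    intro b
    simp [interp, I, S_app, K_app]
  have : omega.interp ρ = (S ⬝ I ⬝ I) ⬝ (S ⬝ I ⬝ I : A) := by rw [← hw]; rfl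
  rw [this]
  rfl

end LambdaTerm

universe u v

namespace LambdaTerm

/-- The closed term `Θ` has the same interpretation under all environments. -/
theorem interp_theta_eq {A : Type*} [CombinatoryAlgebra A] (ρ ρ' : ℕ → A) :
    theta.interp ρ = theta.interp ρ' := by
  simp [theta, termB, termC, interp]

end LambdaTerm

namespace CombinatoryAlgebra

theorem I_app {A : Type*} [CombinatoryAlgebra A] (a : A) : I ⬝ a = a := by
  simp [I, S_app, K_app]

namespace IsEmbedding

variable {A B : Type*} [CombinatoryAlgebra A] [CombinatoryAlgebra B] {f : A → B}

theorem map_eval (hf : IsEmbedding f) (t : GroundTerm) : f (t.eval A) = t.eval B := by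
  induction t with
  | K => exact hf.map_K
  | S => exact hf.map_S
  | app s t ihs iht => simp only [GroundTerm.eval, hf.map_app, ihs, iht]

theorem map_I (hf : IsEmbedding f) : f I = I := by
  simp only [I, hf.map_app, hf.map_K, hf.map_S]

theorem map_one (hf : IsEmbedding f) : f one = one := by
  simp only [one, hf.map_app, hf.map_K, hf.map_S, hf.map_I]

/-- Elements of a `λ`-model that agree as functions have images that agree as functions. -/
theorem map_app_eq_map_app [IsLambdaModel A] (hf : IsEmbedding f) {x y : A}
    (h : ∀ z, x ⬝ z = y ⬝ z) (b : B) : f x ⬝ b = f y ⬝ b := by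
  have h1 := congrArg f (IsLambdaModel.weak_ext x y h)
  rw [hf.map_app, hf.map_app, hf.map_one] at h1
  rw [← LambdaTerm.one_app (f x), h1, LambdaTerm.one_app]

end IsEmbedding

/-- A binary term `s` with `s x x = 0` and `s x 0 = x` forces unorderability at `0`. -/
theorem isUnorderableAt_of_subtractive {B : Type*} [CombinatoryAlgebra B] {s zero : B}
    (h_self : ∀ b, s ⬝ b ⬝ b = zero) (h_zero : ∀ b, s ⬝ b ⬝ zero = b) :
    IsUnorderableAt zero := by
  intro le hle a ha
  constructor <;> intro h <;> apply ha
  · have h1 := hle.app_mono _ _ _ _ (hle.refl (s ⬝ a)) h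
    rw [h_self, h_zero] at h1
    exact hle.antisymm _ _ h1 h
  · have h1 := hle.app_mono _ _ _ _ (hle.refl (s ⬝ a)) h
    rw [h_self, h_zero] at h1
    exact hle.antisymm _ _ h h1

end CombinatoryAlgebra

/-- Every `λ`-model satisfying the subtractive identities `(π)` and `(φ)` is absolutely
`Ω`-unorderable in the variety of combinatory algebras. -/
theorem mainTheorem9 (A : Type u) [CombinatoryAlgebra A] [IsLambdaModel A]
    (hπ : LambdaTerm.SatisfiesPi A) (hφ : LambdaTerm.SatisfiesPhi A) :
    CombinatoryAlgebra.IsAbsolutelyUnorderable.{u, v} CombinatoryAlgebra.GroundTerm.omega A := by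
  open CombinatoryAlgebra LambdaTerm in
  intro B _ f hf
  obtain ⟨s, hs⟩ : ∃ s : A, ∀ ρ, theta.interp ρ = s :=
    ⟨theta.interp fun _ => K, fun ρ => interp_theta_eq ρ _⟩
  have h_self (a : A) : s ⬝ a ⬝ a = GroundTerm.omega.eval A := by
    simpa only [interp, hs, interp_omega] using hπ fun _ => a
  have h_zero (a : A) : s ⬝ a ⬝ GroundTerm.omega.eval A = a := by
    simpa only [interp, hs, interp_omega] using hφ fun _ => a
  refine isUnorderableAt_of_subtractive (s := f s) (fun b => ?_) fun b => ?_
  · have h := hf.map_app_eq_map_app (x := S ⬝ s ⬝ I) (y := K ⬝ GroundTerm.omega.eval A)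
      (fun z => by rw [S_app, I_app, h_self, K_app]) b
    simpa only [hf.map_app, hf.map_S, hf.map_K, hf.map_I, hf.map_eval, S_app, K_app, I_app] using h
  · have h := hf.map_app_eq_map_app (x := S ⬝ s ⬝ (K ⬝ GroundTerm.omega.eval A)) (y := I)
      (fun z => by rw [S_app, K_app, h_zero, I_app]) b
    simpa only [hf.map_app, hf.map_S, hf.map_K, hf.map_I, hf.map_eval, S_app, K_app, I_app] using h
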